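/- Let $\mathbb H^2=\{z\in\mathbb C:\operatorname{Im} z>0\}$ be the hyperbolic plane in the half-plane model, with metric $(dx^2+dy^2)/y^2$ and the orientation of $\mathbb C$. Let $r\in\{2,3,\dots\}\cup\{\infty\}$, let $u,v$ be unit tangent vectors of $\mathbb H^2$, and let $-\infty\le\kappa_1<\kappa_2\le+\infty$. Let $\mathscr C_{\kappa_1}^{\kappa_2}(u,v)$ be the space, with the $C^r$ topology, of all regular curves $\gamma\colon[0,1]\to\mathbb H^2$ of class $C^r$ whose initial and final unit tangent vectors are $u$ and $v$, and whose (signed, hyperbolic) curvature takes values in the open interval $(\kappa_1,\kappa_2)$. For $\tau\in\mathbb R$, let the canonical subspace $\mathscr C_{\kappa_1}^{\kappa_2}(u,v;\tau)$ consist of those $\gamma\in\mathscr C_{\kappa_1}^{\kappa_2}(u,v)$ with total turning $\tau$, that is, such that $\theta(1)-\theta(0)=\tau$ for a continuous $\theta\colon[0,1]\to\mathbb R$ for which $\dot\gamma(t)\in\mathbb C$ is a positive multiple of $e^{i\theta(t)}$ for all $t\in[0,1]$. If $(\kappa_1,\kappa_2)$ is disjoint from $[-1,1]$, then, for every $\tau$,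 the canonical subspace $\mathscr C_{\kappa_1}^{\kappa_2}(u,v;\tau)$ is either empty or contractible. -/

import Mathlib

open scoped UpperHalfPlane

noncomputable section

namespace HypCurves

/-! ### The Riemannian metric of the upper half-plane

Tangent vectors at a point `p` of the half-plane `{z : ℂ | 0 < Im z}` are complex numbers. -/

/-- The Poincaré metric `(dx² + dy²) / y²`, evaluated on two tangent vectors `v`, `w` at `p`. -/
def hypInner (p v w : ℂ) : ℝ := (v * (starRingEnd ℂ) w).re / p.im ^ 2

/-- The hyperbolic length of a tangent vector `v` at `p`. -/
def hypNorm (p v : ℂ) : ℝ := Real.sqrt (hypInner p v v)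

/-- The Christoffel symbols `Γ_p(v, w)` of the Poincaré metric. In real coordinates the nonzero
symbols are `Γ^x_{xy} = Γ^x_{yx} = -1/y`, `Γ^y_{xx} = 1/y`, `Γ^y_{yy} = -1/y`. -/
def christoffel (p v w : ℂ) : ℂ := Complex.I * v * w / (p.im : ℂ)

/-- The Christoffel symbols are symmetric (the connection is torsion free). -/
theorem christoffel_symm (p v w : ℂ) : christoffel p v w = christoffel p w v := by
  unfold christoffel; ring

/-- The connection given by `christoffel` is compatible with the Poincaré metric, hence it is the
Levi-Civita connection. -/
theorem hypInner_hasDerivAt {p : ℂ} (hp : 0 < p.im) (u v w : ℂ) :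
    HasDerivAt (fun s : ℝ => hypInner (p + (s : ℂ) * u) v w)
      (hypInner p (christoffel p u v) w + hypInner p v (christoffel p u w)) 0 := by
  have h1 : HasDerivAt (fun s : ℝ => p.im + s * u.im) u.im 0 := by
    simpa using ((hasDerivAt_id (0 : ℝ)).mul_const u.im).const_add p.im
  have h3 := ((h1.fun_pow 2).fun_inv (by simpa using hp.ne')).const_mul (v * (starRingEnd ℂ) w).re
  have hne : p.im ≠ 0 := hp.ne'
  have hfun : (fun s : ℝ => hypInner (p + (s : ℂ) * u) v w) =
      fun s : ℝ => (v * (starRingEnd ℂ) w).re * ((p.im + s * u.im) ^ 2)⁻¹ := by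
    funext s
    simp [hypInner, div_eq_mul_inv]
  rw [hfun]
  refine h3.congr_deriv ?_
  have e : ∀ z : ℂ, z / (p.im : ℂ) = ((p.im⁻¹ : ℝ) : ℂ) * z := by
    intro z; push_cast; rw [div_eq_mul_inv, mul_comm]
  simp only [hypInner, christoffel, e]
  simp
  field_simp
  ring

theorem hypNorm_eq {p : ℂ} (hp : 0 < p.im) (v : ℂ) : hypNorm p v = ‖v‖ / p.im := by
  unfold hypNorm hypInner
  rw [Complex.mul_conj, Complex.ofReal_re, Real.sqrt_div' _ (sq_nonneg _), Real.sqrt_sq hp.le]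
  rfl

/-- A point of the unit tangent bundle `UTℍ`. -/
@[ext]
structure UnitTangent where
  /-- the base point -/
  base : ℍ
  /-- the tangent vector -/
  vec : ℂ
  norm_vec : hypNorm base vec = 1

/-! ### Regular curves `[0,1] → ℍ` of class `C^r` -/

/-- A map `[0,1] → ℍ`, regarded as a `ℂ`-valued function of a real variable. Only its restriction
to `[0,1]` matters: all derivatives below are derivatives within `[0,1]`. -/
def extend (γ : unitInterval → ℍ) : ℝ → ℂ :=
  Set.IccExtend (zero_le_one : (0 : ℝ) ≤ 1) (fun t => (γ t : ℂ))

/-- The `k`-th derivative of `γ : [0,1] → ℍ ⊆ ℂ` at `t ∈ [0,1]` (one-sided at the endpoints). -/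
def nthDeriv (k : ℕ) (γ : unitInterval → ℍ) (t : unitInterval) : ℂ :=
  iteratedDerivWithin k (extend γ) (Set.Icc 0 1) (t : ℝ)

/-- Regular curves `γ : [0,1] → ℍ` of class `C^r`. -/
structure RegularCurve (r : ℕ∞) where
  /-- the underlying map -/
  toFun : unitInterval → ℍ
  contDiffOn : ContDiffOn ℝ r (extend toFun) (Set.Icc 0 1)
  regular : ∀ t, nthDeriv 1 toFun t ≠ 0

namespace RegularCurve

variable {r : ℕ∞}

/-- The `k`-th derivative, `k ≤ r`, as a continuous function on `[0,1]`. -/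
def derivMap (k : ℕ) (hk : (k : ℕ∞) ≤ r) (γ : RegularCurve r) : C(unitInterval, ℂ) where
  toFun := nthDeriv k γ.toFun
  continuous_toFun := by
    have h := γ.contDiffOn.continuousOn_iteratedDerivWithin (m := k) (by exact_mod_cast hk)
      (uniqueDiffOn_Icc zero_lt_one)
    exact continuousOn_iff_continuous_domRestrict.1 h

/-- The `C^r` topology: uniform convergence on `[0,1]` of the derivatives of every order `k ≤ r`
(every finite order if `r = ∞`). -/
instance : TopologicalSpace (RegularCurve r) :=
  ⨅ (k : ℕ) (hk : (k : ℕ∞) ≤ r), TopologicalSpace.induced (derivMap k hk) inferInstance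

/-- The velocity `γ'(t)`. -/
def velocity (γ : RegularCurve r) (t : unitInterval) : ℂ := nthDeriv 1 γ.toFun t

/-- The hyperbolic speed `|γ'(t)|`. -/
def speed (γ : RegularCurve r) (t : unitInterval) : ℝ := hypNorm (γ.toFun t) (γ.velocity t)

theorem speed_pos (γ : RegularCurve r) (t : unitInterval) : 0 < γ.speed t := by
  unfold speed
  rw [hypNorm_eq (γ.toFun t).im_pos]
  exact div_pos (norm_pos_iff.2 (γ.regular t)) (γ.toFun t).im_pos

/-- The unit tangent `γ'(t) / |γ'(t)| ∈ UTℍ`. -/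
def unitTangent (γ : RegularCurve r) (t : unitInterval) : UnitTangent where
  base := γ.toFun t
  vec := γ.velocity t / (γ.speed t : ℂ)
  norm_vec := by
    have h := γ.speed_pos t
    rw [hypNorm_eq (γ.toFun t).im_pos, norm_div, Complex.norm_real, Real.norm_of_nonneg h.le,
      div_right_comm, ← hypNorm_eq (γ.toFun t).im_pos]
    exact div_self h.ne'

/-- The unit normal: the unit tangent rotated by a quarter turn, counterclockwise. -/
def unitNormal (γ : RegularCurve r) (t : unitInterval) : ℂ := Complex.I * (γ.unitTangent t).vec

/-- The covariant derivative `Dγ'/dt` of the velocity along `γ`. -/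
def acceleration (γ : RegularCurve r) (t : unitInterval) : ℂ :=
  nthDeriv 2 γ.toFun t + christoffel (γ.toFun t) (γ.velocity t) (γ.velocity t)

/-- The (hyperbolic, signed) curvature `⟨Dγ'/dt, n⟩ / |γ'|²`, meaningful if `2 ≤ r`. -/
def curvature (γ : RegularCurve r) (t : unitInterval) : ℝ :=
  hypInner (γ.toFun t) (γ.acceleration t) (γ.unitNormal t) / γ.speed t ^ 2

/-- `θ` is an argument of `γ`: a continuous function such that `γ'(t)` points in the direction of
`e^{iθ(t)}` for every `t`. -/
def IsArgument (γ : RegularCurve r) (θ : C(unitInterval, ℝ)) : Prop :=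
  ∀ t, γ.velocity t = (‖γ.velocity t‖ : ℂ) * Complex.exp ((θ t : ℂ) * Complex.I)

/-- `γ` has total turning `τ`: one has `θ(1) - θ(0) = τ` for an argument `θ` of `γ`. Arguments exist
and differ by constants, so that every regular curve has exactly one total turning. -/
def HasTotalTurning (γ : RegularCurve r) (τ : ℝ) : Prop :=
  ∃ θ : C(unitInterval, ℝ), γ.IsArgument θ ∧ θ 1 - θ 0 = τ

end RegularCurve

/-- The space `𝒞_{κ₁}^{κ₂}(u,v)` of all regular curves of class `C^r` in the hyperbolic plane with
initial unit tangent `u`, final unit tangent `v` and curvature in the open interval `(κ₁, κ₂)`. -/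
def curveSpace (r : ℕ∞) (κ₁ κ₂ : EReal) (u v : UnitTangent) : Set (RegularCurve r) :=
  {γ | γ.unitTangent 0 = u ∧ γ.unitTangent 1 = v ∧
    ∀ t, κ₁ < (γ.curvature t : EReal) ∧ (γ.curvature t : EReal) < κ₂}

/-- The canonical subspace `𝒞_{κ₁}^{κ₂}(u,v;τ)` of the curves of total turning `τ`. -/
def canonicalSubspace (r : ℕ∞) (κ₁ κ₂ : EReal) (u v : UnitTangent) (τ : ℝ) :
    Set (RegularCurve r) :=
  {γ | γ ∈ curveSpace r κ₁ κ₂ u v ∧ γ.HasTotalTurning τ}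

end HypCurves

end

/-!
Let `γ` have Euclidean speed `q`, height `y = im γ` and argument `θ`. Its hyperbolic curvature `κ`
satisfies `κ q = y θ' + q cos θ` (`RegularCurve.curvature_mul`), so that `y θ' = q (κ - cos θ)`. If
`(κ₁, κ₂)` avoids `[-1,1]`, then `θ` is strictly monotone, in the same direction for all admissible
curves, and a curve can be parametrized by its argument. With `ρ = q / θ'`, the Euclidean radius
of curvature as a function of the argument, the conditions on `γ` become linear: `γ` is the
primitive of `ρ(θ) exp(iθ)`, and `κ₁ < κ < κ₂` compares `y + ρ cos θ` with `κ₁ ρ` and `κ₂ ρ`. So the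
curves with given end data and total turning form a convex set in this parametrization, although
the hyperbolic metric is not flat: the Euclidean convex combination of two such curves, matched by
their arguments, has as curvature a weighted mean of the two curvatures
(`mem_canonicalSubspace_of_convexCombination`).

A canonical subspace is therefore contracted to one of its elements `γ₀` by convex combinations
`(1 - s) γ + s (γ₀ ∘ β)`, where `β` matches the arguments of `γ₀` and `γ` (`exists_matching`). Since
the argument of a `C^r` curve is only `C^{r-1}`, so is `β`, and one derivative is lost. It is
recovered by a reparametrization `χ` that makes the arc length of the combination equal
to the convex combination of the arc lengths of `γ` and `γ₀` in their own parameters. This function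
is `C^r`, and the velocity is its derivative times `exp(iθ)`, where the argument `θ ∘ χ` is
`C^{r-1}`. The choice also makes the deformation start at `γ` and end at `γ₀`
(`contractibleSpace_canonicalSubspace`).

Continuity in the `C^r` topology is handled by `ContDiffFamily`: families of functions on `[0,1]`
whose derivatives are continuous jointly in the parameter and in `t`. These are closed under the
algebraic operations, composition, primitives and the solution of monotone equations
(`exists_reparametrization`), and describe the continuous maps into the space of curves
(`RegularCurve.contDiffFamily_extend`, `RegularCurve.continuous_of_contDiffFamily`).
-/

noncomputable section

namespace HypCurves

open Set Filter Topology

/-! ### Families of `C^k` functions on the unit interval -/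

/-- A family `f x : ℝ → E`, `x ∈ X`, of functions that are `C^k` on `[0,1]`, all of whose
derivatives of order at most `k` (taken within `[0,1]`) are continuous jointly in `x ∈ X` and
`t ∈ [0,1]`. The values off `[0,1]` do not matter. -/
def ContDiffFamily {X E : Type*} [TopologicalSpace X] [NormedAddCommGroup E] [NormedSpace ℝ E] :
    ℕ → (X → ℝ → E) → Prop
  | 0, f => ContinuousOn (Function.uncurry f) (univ ×ˢ Icc 0 1)
  | k + 1, f => ContinuousOn (Function.uncurry f) (univ ×ˢ Icc 0 1) ∧
      (∀ x, DifferentiableOn ℝ (f x) (Icc 0 1)) ∧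
      ContDiffFamily k fun x => derivWithin (f x) (Icc 0 1)

theorem uniqueDiffOn_unitInterval : UniqueDiffOn ℝ (Icc (0 : ℝ) 1) :=
  uniqueDiffOn_Icc zero_lt_one

namespace ContDiffFamily

variable {X Y E F G : Type*} [TopologicalSpace X] [TopologicalSpace Y]
  [NormedAddCommGroup E] [NormedSpace ℝ E] [NormedAddCommGroup F] [NormedSpace ℝ F]
  [NormedAddCommGroup G] [NormedSpace ℝ G] {k : ℕ} {f g : X → ℝ → E}

theorem continuousOn (hf : ContDiffFamily k f) :
    ContinuousOn (Function.uncurry f) (univ ×ˢ Icc 0 1) := by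
  cases k with
  | zero => exact hf
  | succ k => exact hf.1

theorem differentiableOn (hf : ContDiffFamily (k + 1) f) (x : X) :
    DifferentiableOn ℝ (f x) (Icc 0 1) := hf.2.1 x

theorem hasDerivWithinAt (hf : ContDiffFamily (k + 1) f) (x : X) {t : ℝ} (ht : t ∈ Icc (0 : ℝ) 1) :
    HasDerivWithinAt (f x) (derivWithin (f x) (Icc 0 1) t) (Icc 0 1) t :=
  (hf.2.1 x t ht).hasDerivWithinAt

theorem derivWithin (hf : ContDiffFamily (k + 1) f) :
    ContDiffFamily k fun x => derivWithin (f x) (Icc 0 1) := hf.2.2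

theorem congr (hf : ContDiffFamily k f) (h : ∀ x, ∀ t ∈ Icc (0 : ℝ) 1, g x t = f x t) :
    ContDiffFamily k g := by
  induction k generalizing f g with
  | zero => exact ContinuousOn.congr hf fun p hp => h p.1 p.2 hp.2
  | succ k ih =>
    refine ⟨hf.1.congr fun p hp => h p.1 p.2 hp.2, fun x => (hf.2.1 x).congr (h x), ih hf.2.2 ?_⟩
    exact fun x t ht => derivWithin_congr (h x) (h x t ht)

theorem of_succ (hf : ContDiffFamily (k + 1) f) : ContDiffFamily k f := by
  induction k generalizing f with
  | zero => exact hf.1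
  | succ k ih => exact ⟨hf.1, hf.2.1, ih hf.2.2⟩

theorem of_le {j : ℕ} (hf : ContDiffFamily k f) (h : j ≤ k) : ContDiffFamily j f := by
  induction k, h using Nat.le_induction with
  | base => exact hf
  | succ n _ ih => exact ih hf.of_succ

/-- A family is `C^{k+1}` as soon as its derivative is a `C^k` family. -/
theorem succ_of_hasDerivWithinAt {f' : X → ℝ → E} (h0 : ContDiffFamily 0 f)
    (h : ∀ x, ∀ t ∈ Icc (0 : ℝ) 1, HasDerivWithinAt (f x) (f' x t) (Icc 0 1) t)
    (hf' : ContDiffFamily k f') : ContDiffFamily (k + 1) f :=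
  ⟨h0, fun x t ht => (h x t ht).differentiableWithinAt,
    hf'.congr fun x t ht => (h x t ht).derivWithin (uniqueDiffOn_unitInterval t ht)⟩

theorem continuous_eval (hf : ContDiffFamily k f) {Z : Type*} [TopologicalSpace Z] {a : Z → X}
    {b : Z → ℝ} (ha : Continuous a) (hb : Continuous b) (hb' : ∀ z, b z ∈ Icc (0 : ℝ) 1) :
    Continuous fun z => f (a z) (b z) :=
  hf.continuousOn.comp_continuous (ha.prodMk hb) fun z => ⟨mem_univ _, hb' z⟩

theorem const_param {c : X → E} (hc : Continuous c) : ContDiffFamily k fun x (_ : ℝ) => c x := by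
  induction k generalizing c with
  | zero => exact (hc.comp continuous_fst).continuousOn
  | succ k ih =>
    refine succ_of_hasDerivWithinAt (f' := fun _ _ => 0)
      (hc.comp continuous_fst).continuousOn (fun x t _ => hasDerivWithinAt_const _ _ _) ?_
    exact ih (c := fun _ => 0) continuous_const

theorem comp_param (hf : ContDiffFamily k f) {φ : Y → X} (hφ : Continuous φ) :
    ContDiffFamily k fun y => f (φ y) := by
  induction k generalizing f with
  | zero =>
    refine ContinuousOn.comp (f := fun p : Y × ℝ => (φ p.1, p.2)) hf (by fun_prop) ?_
    exact fun p hp => ⟨mem_univ _, hp.2⟩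
  | succ k ih =>
    refine ⟨?_, fun y => hf.2.1 _, ih hf.2.2⟩
    refine ContinuousOn.comp (f := fun p : Y × ℝ => (φ p.1, p.2)) hf.1 (by fun_prop) ?_
    exact fun p hp => ⟨mem_univ _, hp.2⟩

theorem add (hf : ContDiffFamily k f) (hg : ContDiffFamily k g) :
    ContDiffFamily k fun x t => f x t + g x t := by
  induction k generalizing f g with
  | zero => exact ContinuousOn.add hf hg
  | succ k ih =>
    exact succ_of_hasDerivWithinAt (hf.1.add hg.1)
      (fun x t ht => (hf.hasDerivWithinAt x ht).add (hg.hasDerivWithinAt x ht))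
      (ih hf.2.2 hg.2.2)

theorem clm_comp (L : E →L[ℝ] F) (hf : ContDiffFamily k f) :
    ContDiffFamily k fun x t => L (f x t) := by
  induction k generalizing f with
  | zero => exact L.continuous.comp_continuousOn hf
  | succ k ih =>
    exact succ_of_hasDerivWithinAt (L.continuous.comp_continuousOn hf.1)
      (fun x t ht => L.hasFDerivAt.comp_hasDerivWithinAt t (hf.hasDerivWithinAt x ht))
      (ih hf.2.2)

theorem bilinear (B : E →L[ℝ] F →L[ℝ] G) {g : X → ℝ → F} (hf : ContDiffFamily k f)
    (hg : ContDiffFamily k g) : ContDiffFamily k fun x t => B (f x t) (g x t) := by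
  have h0 : ∀ {f : X → ℝ → E} {g : X → ℝ → F}, ContDiffFamily 0 f → ContDiffFamily 0 g →
      ContDiffFamily 0 fun x t => B (f x t) (g x t) := fun {f g} hf hg =>
    (B.continuous.comp_continuousOn hf).clm_apply hg
  induction k generalizing f g with
  | zero => exact h0 hf hg
  | succ k ih =>
    exact succ_of_hasDerivWithinAt (h0 hf.1 hg.1)
      (fun x t ht => B.hasDerivWithinAt_of_bilinear (hf.hasDerivWithinAt x ht)
        (hg.hasDerivWithinAt x ht))
      ((ih hf.of_succ hg.2.2).add (ih hf.2.2 hg.of_succ))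

theorem smul {a : X → ℝ → ℝ} (ha : ContDiffFamily k a) (hf : ContDiffFamily k f) :
    ContDiffFamily k fun x t => a x t • f x t :=
  bilinear (ContinuousLinearMap.lsmul ℝ ℝ) ha hf

theorem mul {A : Type*} [NormedRing A] [NormedAlgebra ℝ A] {f g : X → ℝ → A}
    (hf : ContDiffFamily k f) (hg : ContDiffFamily k g) :
    ContDiffFamily k fun x t => f x t * g x t :=
  bilinear (ContinuousLinearMap.mul ℝ A) hf hg

theorem neg (hf : ContDiffFamily k f) : ContDiffFamily k fun x t => -f x t :=
  clm_comp (-ContinuousLinearMap.id ℝ E) hf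

theorem inv {A : Type*} [NormedField A] [NormedAlgebra ℝ A] {f : X → ℝ → A}
    (hf : ContDiffFamily k f) (h : ∀ x, ∀ t ∈ Icc (0 : ℝ) 1, f x t ≠ 0) :
    ContDiffFamily k fun x t => (f x t)⁻¹ := by
  induction k with
  | zero => exact ContinuousOn.inv₀ hf fun p hp => h p.1 p.2 hp.2
  | succ k ih =>
    refine succ_of_hasDerivWithinAt (hf.1.inv₀ fun p hp => h p.1 p.2 hp.2)
      (f' := fun x t => -(_root_.derivWithin (f x) (Icc 0 1) t * ((f x t)⁻¹ * (f x t)⁻¹)))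
      (fun x t ht => ?_) (hf.2.2.mul ((ih hf.of_succ).mul (ih hf.of_succ))).neg
    have h1 := hasFDerivAt_inv' (𝕜 := ℝ) (h x t ht)
    have h2 := h1.comp_hasDerivWithinAt t (hf.hasDerivWithinAt x ht)
    refine h2.congr_deriv ?_
    simp only [_root_.neg_apply, ContinuousLinearMap.mulLeftRight_apply]
    ring

theorem cexp {f : X → ℝ → ℂ} (hf : ContDiffFamily k f) :
    ContDiffFamily k fun x t => Complex.exp (f x t) := by
  have h0 : ∀ {f : X → ℝ → ℂ}, ContDiffFamily 0 f → ContDiffFamily 0 fun x t => Complex.exp (f x t) :=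
    fun hf => Complex.continuous_exp.comp_continuousOn hf
  induction k with
  | zero => exact h0 hf
  | succ k ih =>
    exact succ_of_hasDerivWithinAt (h0 hf.1)
      (fun x t ht => (hf.hasDerivWithinAt x ht).cexp) ((ih hf.of_succ).mul hf.2.2)

theorem re {f : X → ℝ → ℂ} (hf : ContDiffFamily k f) : ContDiffFamily k fun x t => (f x t).re :=
  clm_comp Complex.reCLM hf

theorem im {f : X → ℝ → ℂ} (hf : ContDiffFamily k f) : ContDiffFamily k fun x t => (f x t).im :=
  clm_comp Complex.imCLM hf

theorem ofReal {f : X → ℝ → ℝ} (hf : ContDiffFamily k f) :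
    ContDiffFamily k fun x t => (f x t : ℂ) :=
  clm_comp Complex.ofRealCLM hf

/-- The composition of `C^k` families, with the same parameter. -/
theorem comp {h : X → ℝ → ℝ} (hf : ContDiffFamily k f) (hh : ContDiffFamily k h)
    (hmem : ∀ x, ∀ t ∈ Icc (0 : ℝ) 1, h x t ∈ Icc (0 : ℝ) 1) :
    ContDiffFamily k fun x t => f x (h x t) := by
  have h0 : ∀ {f : X → ℝ → E}, ContDiffFamily 0 f → ContDiffFamily 0 fun x t => f x (h x t) := by
    intro f hf
    refine ContinuousOn.comp (f := fun p : X × ℝ => (p.1, h p.1 p.2)) hf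
      (continuousOn_fst.prodMk hh.continuousOn) ?_
    exact fun p hp => ⟨mem_univ _, hmem p.1 p.2 hp.2⟩
  induction k generalizing f with
  | zero => exact h0 hf
  | succ k ih =>
    refine succ_of_hasDerivWithinAt (h0 hf.1) (fun x t ht => ?_)
      (hh.2.2.smul (ih hf.2.2 hh.of_succ))
    exact (hf.hasDerivWithinAt x (hmem x t ht)).scomp t (hh.hasDerivWithinAt x ht) (hmem x)

theorem contDiffOn (hf : ContDiffFamily k f) (x : X) : ContDiffOn ℝ k (f x) (Icc 0 1) := by
  induction k generalizing f with
  | zero =>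
    refine contDiffOn_zero.2 (ContinuousOn.comp (f := fun t : ℝ => (x, t)) hf (by fun_prop) ?_)
    exact fun t ht => ⟨mem_univ _, ht⟩
  | succ k ih =>
    push_cast
    refine (contDiffOn_succ_iff_derivWithin uniqueDiffOn_unitInterval).2
      ⟨hf.2.1 x, ?_, ih hf.2.2⟩
    intro h
    exact absurd h (by simp)

theorem continuousOn_iteratedDerivWithin (hf : ContDiffFamily k f) :
    ContinuousOn (fun p : X × ℝ => iteratedDerivWithin k (f p.1) (Icc 0 1) p.2)
      (univ ×ˢ Icc 0 1) := by
  induction k generalizing f with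
  | zero => simpa [iteratedDerivWithin_zero] using! hf.continuousOn
  | succ k ih =>
    simp only [iteratedDerivWithin_succ']
    exact ih hf.2.2

theorem of_iteratedDerivWithin (h : ∀ x, ContDiffOn ℝ k (f x) (Icc 0 1))
    (hc : ∀ j ≤ k, ContinuousOn (fun p : X × ℝ => iteratedDerivWithin j (f p.1) (Icc 0 1) p.2)
      (univ ×ˢ Icc 0 1)) : ContDiffFamily k f := by
  have h0 : ContinuousOn (Function.uncurry f) (univ ×ˢ Icc 0 1) := by
    simpa [iteratedDerivWithin_zero] using! hc 0 (Nat.zero_le _)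
  induction k generalizing f with
  | zero => exact h0
  | succ k ih =>
    push_cast at h
    have h' := fun x => (contDiffOn_succ_iff_derivWithin uniqueDiffOn_unitInterval).1 (h x)
    have hc' : ∀ j ≤ k, ContinuousOn (fun p : X × ℝ => iteratedDerivWithin j
        (_root_.derivWithin (f p.1) (Icc 0 1)) (Icc 0 1) p.2) (univ ×ˢ Icc 0 1) := by
      intro j hj
      simpa only [iteratedDerivWithin_succ'] using hc (j + 1) (by omega)
    refine ⟨h0, fun x => (h' x).1, ih (fun x => (h' x).2.2) hc' ?_⟩
    simpa [iteratedDerivWithin_zero] using! hc' 0 (Nat.zero_le _)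

end ContDiffFamily

/-! ### Primitives -/

/-- The primitive on `[0,1]`, vanishing at `0`, of the restriction of `f` to `[0,1]`. The integrand
is extended by constants to `ℝ`. -/
def primitive {E : Type*} [NormedAddCommGroup E] [NormedSpace ℝ E] (f : ℝ → E) (t : ℝ) : E :=
  ∫ s in (0 : ℝ)..t, f (projIcc (0 : ℝ) 1 zero_le_one s)

section Primitive

variable {X E : Type*} [TopologicalSpace X] [NormedAddCommGroup E] [NormedSpace ℝ E]

@[simp]
theorem primitive_zero (f : ℝ → E) : primitive f 0 = 0 := by simp [primitive]

theorem hasDerivWithinAt_primitive [CompleteSpace E] {f : ℝ → E}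
    (hf : ContinuousOn f (Icc 0 1)) {t : ℝ} (ht : t ∈ Icc (0 : ℝ) 1) :
    HasDerivWithinAt (primitive f) (f t) (Icc 0 1) t := by
  have hc : Continuous fun s => f (projIcc (0 : ℝ) 1 zero_le_one s) :=
    hf.comp_continuous (continuous_subtype_val.comp continuous_projIcc) fun s => Subtype.coe_prop _
  have := (hc.integral_hasStrictDerivAt 0 t).hasDerivAt.hasDerivWithinAt (s := Icc (0 : ℝ) 1)
  rw [projIcc_of_mem zero_le_one ht] at this
  exact this

theorem ContDiffFamily.slice {k : ℕ} {f : X → ℝ → E} (hf : ContDiffFamily k f) (x : X) :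
    ContinuousOn (f x) (Icc 0 1) :=
  (hf.contDiffOn x).continuousOn

theorem ContDiffFamily.primitive_zero {f : X → ℝ → E} (hf : ContDiffFamily 0 f) :
    ContDiffFamily 0 fun x => primitive (f x) := by
  refine Continuous.continuousOn ?_
  refine intervalIntegral.continuous_parametric_primitive_of_continuous (a₀ := 0)
    (f := fun x s => f x (projIcc (0 : ℝ) 1 zero_le_one s)) ?_
  exact hf.continuous_eval continuous_fst
    (continuous_subtype_val.comp (continuous_projIcc.comp continuous_snd))
    fun _ => Subtype.coe_prop _

theorem ContDiffFamily.primitive [CompleteSpace E] {k : ℕ} {f : X → ℝ → E}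
    (hf : ContDiffFamily k f) : ContDiffFamily (k + 1) fun x => primitive (f x) :=
  .succ_of_hasDerivWithinAt (hf.of_le (Nat.zero_le _)).primitive_zero
    (fun x _ ht => hasDerivWithinAt_primitive (hf.slice x) ht) hf

end Primitive

/-! ### Implicitly defined families -/

section Implicit

variable {X : Type*} [TopologicalSpace X] {P G χ : X → ℝ → ℝ}

theorem strictMonoOn_of_hasDerivWithinAt_pos {p p' : ℝ → ℝ}
    (h : ∀ t ∈ Icc (0 : ℝ) 1, HasDerivWithinAt p (p' t) (Icc 0 1) t)
    (hpos : ∀ t ∈ Icc (0 : ℝ) 1, 0 < p' t) : StrictMonoOn p (Icc 0 1) := by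
  refine strictMonoOn_of_deriv_pos (convex_Icc 0 1)
    (fun t ht => (h t ht).continuousWithinAt) fun t ht => ?_
  have ht' := interior_subset ht
  rw [((h t ht').hasDerivAt (mem_interior_iff_mem_nhds.1 ht)).deriv]
  exact hpos t ht'

/-- The solution `χ` of `P x (χ x t) = G x t` is continuous if `P x` is strictly increasing. -/
theorem ContDiffFamily.implicit_zero (hP : ContDiffFamily 0 P) (hG : ContDiffFamily 0 G)
    (hmono : ∀ x, StrictMonoOn (P x) (Icc 0 1))
    (hmem : ∀ x, ∀ t ∈ Icc (0 : ℝ) 1, χ x t ∈ Icc (0 : ℝ) 1)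
    (heq : ∀ x, ∀ t ∈ Icc (0 : ℝ) 1, P x (χ x t) = G x t) : ContDiffFamily 0 χ := by
  rintro ⟨x₀, t₀⟩ ⟨-, ht₀⟩
  have hPa : ∀ a ∈ Icc (0 : ℝ) 1, ContinuousWithinAt (fun p : X × ℝ => P p.1 a)
      (univ ×ˢ Icc 0 1) (x₀, t₀) := fun a ha =>
    (hP.continuous_eval continuous_fst continuous_const fun _ => ha).continuousWithinAt
  have hG₀ : ContinuousWithinAt (fun p : X × ℝ => G p.1 p.2) (univ ×ˢ Icc 0 1) (x₀, t₀) :=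
    hG (x₀, t₀) ⟨mem_univ _, ht₀⟩
  have h₀ := hmem x₀ t₀ ht₀
  refine tendsto_order.2 ⟨fun a ha => ?_, fun a ha => ?_⟩
  · rcases lt_or_ge a 0 with h | h
    · filter_upwards [self_mem_nhdsWithin] with p hp
      exact h.trans_le (hmem p.1 p.2 hp.2).1
    · have ha' : a ∈ Icc (0 : ℝ) 1 := ⟨h, ha.le.trans h₀.2⟩
      have : P x₀ a < G x₀ t₀ := heq x₀ t₀ ht₀ ▸ hmono x₀ ha' h₀ ha
      filter_upwards [(hPa a ha').eventually_lt hG₀ this, self_mem_nhdsWithin] with p hp hp'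
      rw [← heq p.1 p.2 hp'.2] at hp
      exact ((hmono p.1).lt_iff_lt ha' (hmem p.1 p.2 hp'.2)).1 hp
  · rcases lt_or_ge 1 a with h | h
    · filter_upwards [self_mem_nhdsWithin] with p hp
      exact (hmem p.1 p.2 hp.2).2.trans_lt h
    · have ha' : a ∈ Icc (0 : ℝ) 1 := ⟨h₀.1.trans ha.le, h⟩
      have : G x₀ t₀ < P x₀ a := heq x₀ t₀ ht₀ ▸ hmono x₀ h₀ ha' ha
      filter_upwards [hG₀.eventually_lt (hPa a ha') this, self_mem_nhdsWithin] with p hp hp'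
      rw [← heq p.1 p.2 hp'.2] at hp
      exact ((hmono p.1).lt_iff_lt (hmem p.1 p.2 hp'.2) ha').1 hp

/-- The derivative of the solution `c` of `p (c t) = g t`. -/
theorem hasDerivWithinAt_implicit {p g c : ℝ → ℝ} {p' g' t : ℝ} (ht : t ∈ Icc (0 : ℝ) 1)
    (hmem : ∀ t ∈ Icc (0 : ℝ) 1, c t ∈ Icc (0 : ℝ) 1)
    (heq : ∀ t ∈ Icc (0 : ℝ) 1, p (c t) = g t) (hc : ContinuousWithinAt c (Icc 0 1) t)
    (hp : HasDerivWithinAt p p' (Icc 0 1) (c t)) (hp' : p' ≠ 0)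
    (hg : HasDerivWithinAt g g' (Icc 0 1) t) : HasDerivWithinAt c (g' / p') (Icc 0 1) t := by
  have h : HasFDerivWithinAt c ((ContinuousLinearMap.toSpanSingleton ℝ p'⁻¹) ∘L
      (ContinuousLinearMap.toSpanSingleton ℝ g')) (Icc 0 1) t := by
    refine HasFDerivWithinAt.of_comp_of_leftInverse (f := p) (t := Icc 0 1)
      (tendsto_nhdsWithin_iff.2 ⟨hc, ?_⟩) hp.hasFDerivWithinAt hg.hasFDerivWithinAt ?_ ?_ ht
    · filter_upwards [self_mem_nhdsWithin] with s hs using hmem s hs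
    · filter_upwards [self_mem_nhdsWithin] with s hs using heq s hs
    · intro u
      simp [hp']
  refine h.hasDerivWithinAt.congr_deriv ?_
  simp [div_eq_mul_inv]

/-- The solution of `P x (χ x t) = G x t` is as regular as `P` and `G`: by the formula
`χ' = G' / P'(χ)`, each derivative of `χ` depends only on lower ones. -/
theorem ContDiffFamily.implicit {k : ℕ} (hP1 : ContDiffFamily 1 P) (hG1 : ContDiffFamily 1 G)
    (hP : ContDiffFamily k P) (hG : ContDiffFamily k G)
    (hpos : ∀ x, ∀ t ∈ Icc (0 : ℝ) 1, 0 < _root_.derivWithin (P x) (Icc 0 1) t)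
    (hmem : ∀ x, ∀ t ∈ Icc (0 : ℝ) 1, χ x t ∈ Icc (0 : ℝ) 1)
    (heq : ∀ x, ∀ t ∈ Icc (0 : ℝ) 1, P x (χ x t) = G x t) : ContDiffFamily k χ := by
  have hmono := fun x => strictMonoOn_of_hasDerivWithinAt_pos
    (fun t ht => hP1.hasDerivWithinAt x ht) (hpos x)
  have h0 := implicit_zero hP1.of_succ hG1.of_succ hmono hmem heq
  induction k with
  | zero => exact h0
  | succ k ih =>
    refine succ_of_hasDerivWithinAt h0
      (fun x t ht => hasDerivWithinAt_implicit ht (hmem x) (heq x) (h0.slice x t ht)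
        (hP1.hasDerivWithinAt x (hmem x t ht)) (hpos x _ (hmem x t ht)).ne'
        (hG1.hasDerivWithinAt x ht)) ?_
    simp only [div_eq_mul_inv]
    exact hG.2.2.mul ((hP.2.2.comp (ih hP.of_succ hG.of_succ) hmem).inv
      fun x t ht => (hpos x _ (hmem x t ht)).ne')

/-- Two families of increasing functions with the same values at `0` and `1` differ by
reparametrizations `χ x` of `[0,1]`, and these are as regular as the two families. -/
theorem exists_reparametrization (hP : ContDiffFamily 1 P) (hG : ContDiffFamily 1 G)
    (hPpos : ∀ x, ∀ t ∈ Icc (0 : ℝ) 1, 0 < derivWithin (P x) (Icc 0 1) t)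
    (hGpos : ∀ x, ∀ t ∈ Icc (0 : ℝ) 1, 0 < derivWithin (G x) (Icc 0 1) t)
    (h0 : ∀ x, P x 0 = G x 0) (h1 : ∀ x, P x 1 = G x 1) :
    ∃ χ : X → ℝ → ℝ, (∀ x, ∀ t ∈ Icc (0 : ℝ) 1, χ x t ∈ Icc (0 : ℝ) 1) ∧
      (∀ x, ∀ t ∈ Icc (0 : ℝ) 1, P x (χ x t) = G x t) ∧
      (∀ x, χ x 0 = 0) ∧ (∀ x, χ x 1 = 1) ∧
      (∀ x, ∀ t ∈ Icc (0 : ℝ) 1, HasDerivWithinAt (χ x)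
        (derivWithin (G x) (Icc 0 1) t / derivWithin (P x) (Icc 0 1) (χ x t)) (Icc 0 1) t) ∧
      ∀ k, ContDiffFamily k P → ContDiffFamily k G → ContDiffFamily k χ := by
  have hPmono := fun x => strictMonoOn_of_hasDerivWithinAt_pos
    (fun t ht => hP.hasDerivWithinAt x ht) (hPpos x)
  have hGmono := fun x => strictMonoOn_of_hasDerivWithinAt_pos
    (fun t ht => hG.hasDerivWithinAt x ht) (hGpos x)
  have m0 : (0 : ℝ) ∈ Icc (0 : ℝ) 1 := by simp
  have m1 : (1 : ℝ) ∈ Icc (0 : ℝ) 1 := by simp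
  have hex : ∀ x t, ∃ c, t ∈ Icc (0 : ℝ) 1 → c ∈ Icc (0 : ℝ) 1 ∧ P x c = G x t := by
    intro x t
    by_cases ht : t ∈ Icc (0 : ℝ) 1
    · have hsub := intermediate_value_Icc zero_le_one (hP.slice x)
      obtain ⟨c, hc, hc'⟩ := hsub ⟨(h0 x).trans_le ((hGmono x).monotoneOn m0 ht ht.1),
        ((hGmono x).monotoneOn ht m1 ht.2).trans (h1 x).ge⟩
      exact ⟨c, fun _ => ⟨hc, hc'⟩⟩
    · exact ⟨0, fun h => absurd h ht⟩
  choose χ hχ using hex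
  have hmem : ∀ x, ∀ t ∈ Icc (0 : ℝ) 1, χ x t ∈ Icc (0 : ℝ) 1 := fun x t ht => (hχ x t ht).1
  have heq : ∀ x, ∀ t ∈ Icc (0 : ℝ) 1, P x (χ x t) = G x t := fun x t ht => (hχ x t ht).2
  refine ⟨χ, hmem, heq, fun x => (hPmono x).injOn (hmem x 0 m0) m0 ?_,
    fun x => (hPmono x).injOn (hmem x 1 m1) m1 ?_, fun x t ht => ?_, fun k hPk hGk => ?_⟩
  · rw [heq x 0 m0, h0]
  · rw [heq x 1 m1, h1]
  · exact hasDerivWithinAt_implicit ht (hmem x) (heq x)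
      ((ContDiffFamily.implicit_zero hP.of_succ hG.of_succ hPmono hmem heq).slice x t ht)
      (hP.hasDerivWithinAt x (hmem x t ht)) (hPpos x _ (hmem x t ht)).ne'
      (hG.hasDerivWithinAt x ht)
  · exact ContDiffFamily.implicit hP hG hPk hGk hPpos hmem heq

end Implicit

/-! ### Velocity, argument and length of a regular curve -/

namespace RegularCurve

variable {r : ℕ∞}

/-- The velocity of `γ`, as a function on `ℝ`; meaningful on `[0,1]`. -/
def vel (γ : RegularCurve r) : ℝ → ℂ := derivWithin (extend γ.toFun) (Icc 0 1)

/-- The second derivative of `γ`, as a function on `ℝ`; meaningful on `[0,1]` if `2 ≤ r`. -/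
def acc (γ : RegularCurve r) : ℝ → ℂ := derivWithin γ.vel (Icc 0 1)

theorem velocity_eq (γ : RegularCurve r) (t : unitInterval) : γ.velocity t = γ.vel t := by
  simp [velocity, nthDeriv, iteratedDerivWithin_one, vel]

theorem nthDeriv_two (γ : RegularCurve r) (t : unitInterval) : nthDeriv 2 γ.toFun t = γ.acc t := by
  rw [nthDeriv, iteratedDerivWithin_succ', iteratedDerivWithin_one]
  rfl

theorem vel_ne_zero (γ : RegularCurve r) {t : ℝ} (ht : t ∈ Icc (0 : ℝ) 1) : γ.vel t ≠ 0 := by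
  rw [← γ.velocity_eq ⟨t, ht⟩]
  exact γ.regular _

theorem extend_coe (f : unitInterval → ℍ) (t : unitInterval) : extend f t = f t :=
  IccExtend_val _ _ _

theorem continuous_derivMap (k : ℕ) (hk : (k : ℕ∞) ≤ r) :
    Continuous (derivMap (r := r) k hk) :=
  continuous_iInf_dom (i := k) (continuous_iInf_dom (i := hk) continuous_induced_dom)

/-- The tautological family of all regular curves of class `C^r`. -/
theorem contDiffFamily_extend {k : ℕ} (hk : (k : ℕ∞) ≤ r) :
    ContDiffFamily k fun γ : RegularCurve r => extend γ.toFun := by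
  refine .of_iteratedDerivWithin (fun γ => γ.contDiffOn.of_le (by exact_mod_cast hk))
    fun j hj => ?_
  have hj' : (j : ℕ∞) ≤ r := le_trans (by exact_mod_cast hj) hk
  have hc : Continuous fun p : RegularCurve r × ℝ =>
      derivMap j hj' p.1 (projIcc (0 : ℝ) 1 zero_le_one p.2) :=
    ((continuous_derivMap j hj').comp continuous_fst).eval
      (continuous_projIcc.comp continuous_snd)
  refine hc.continuousOn.congr fun p hp => ?_
  change _ = derivMap j hj' p.1 (projIcc (0 : ℝ) 1 zero_le_one p.2)
  rw [projIcc_of_mem zero_le_one hp.2]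
  rfl

/-- A map into the space of regular curves that comes from `C^k` families, `k ≤ r`, is
continuous. -/
theorem continuous_of_contDiffFamily {X : Type*} [TopologicalSpace X] {φ : X → RegularCurve r}
    (h : ∀ k : ℕ, (k : ℕ∞) ≤ r → ContDiffFamily k fun x => extend (φ x).toFun) :
    Continuous φ := by
  refine continuous_iInf_rng.2 fun k => continuous_iInf_rng.2 fun hk => continuous_induced_rng.2 ?_
  refine ContinuousMap.continuous_of_continuous_uncurry _ ?_
  exact (h k hk).continuousOn_iteratedDerivWithin.comp_continuous
    (f := fun p : X × unitInterval => (p.1, (p.2 : ℝ))) (by fun_prop)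
    fun p => ⟨mem_univ _, p.2.2⟩

theorem contDiffFamily_vel {k : ℕ} (hk : ((k + 1 : ℕ) : ℕ∞) ≤ r) :
    ContDiffFamily k fun γ : RegularCurve r => γ.vel :=
  (contDiffFamily_extend hk).derivWithin

theorem contDiffFamily_acc {k : ℕ} (hk : ((k + 2 : ℕ) : ℕ∞) ≤ r) :
    ContDiffFamily k fun γ : RegularCurve r => γ.acc :=
  (contDiffFamily_vel (k := k + 1) hk).derivWithin

theorem hasDerivWithinAt_extend (hr : 2 ≤ r) (γ : RegularCurve r) {t : ℝ}
    (ht : t ∈ Icc (0 : ℝ) 1) : HasDerivWithinAt (extend γ.toFun) (γ.vel t) (Icc 0 1) t :=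
  (contDiffFamily_extend (r := r) (k := 2) hr).hasDerivWithinAt γ ht

theorem hasDerivWithinAt_vel (hr : 2 ≤ r) (γ : RegularCurve r) {t : ℝ}
    (ht : t ∈ Icc (0 : ℝ) 1) : HasDerivWithinAt γ.vel (γ.acc t) (Icc 0 1) t :=
  (contDiffFamily_vel (r := r) (k := 1) hr).hasDerivWithinAt γ ht

/-- The continuous logarithm of the velocity that vanishes at `0`, as the primitive of
`γ'' / γ'`; so `γ' = γ'(0) * exp logVel`. -/
def logVel (γ : RegularCurve r) : ℝ → ℂ := primitive fun s => γ.acc s * (γ.vel s)⁻¹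

theorem contDiffFamily_logDeriv {k : ℕ} (hk : ((k + 2 : ℕ) : ℕ∞) ≤ r) :
    ContDiffFamily k fun (γ : RegularCurve r) s => γ.acc s * (γ.vel s)⁻¹ :=
  (contDiffFamily_acc hk).mul
    ((contDiffFamily_vel (k := k + 1) hk).of_succ.inv fun γ _ ht => γ.vel_ne_zero ht)

theorem contDiffFamily_logVel (hr : 2 ≤ r) {k : ℕ} (hk : ((k + 1 : ℕ) : ℕ∞) ≤ r) :
    ContDiffFamily k fun γ : RegularCurve r => γ.logVel := by
  cases k with
  | zero => exact (contDiffFamily_logDeriv (k := 0) hr).primitive.of_succ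
  | succ k => exact (contDiffFamily_logDeriv hk).primitive

theorem hasDerivWithinAt_logVel (hr : 2 ≤ r) (γ : RegularCurve r) {t : ℝ}
    (ht : t ∈ Icc (0 : ℝ) 1) :
    HasDerivWithinAt γ.logVel (γ.acc t * (γ.vel t)⁻¹) (Icc 0 1) t :=
  hasDerivWithinAt_primitive ((contDiffFamily_logDeriv (k := 0) hr).slice γ) ht

theorem vel_eq_mul_exp_logVel (hr : 2 ≤ r) (γ : RegularCurve r) {t : ℝ}
    (ht : t ∈ Icc (0 : ℝ) 1) : γ.vel t = γ.vel 0 * Complex.exp (γ.logVel t) := by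
  have hd : ∀ s ∈ Icc (0 : ℝ) 1, HasDerivWithinAt (fun s => γ.vel s * Complex.exp (-γ.logVel s))
      0 (Icc 0 1) s := by
    intro s hs
    refine ((γ.hasDerivWithinAt_vel hr hs).mul
      (γ.hasDerivWithinAt_logVel hr hs).neg.cexp).congr_deriv ?_
    field_simp [γ.vel_ne_zero hs]
    ring
  have h := constant_of_derivWithin_zero (fun s hs => (hd s hs).differentiableWithinAt)
    (fun s hs => (hd s (Ico_subset_Icc_self hs)).derivWithin
      (uniqueDiffOn_unitInterval s (Ico_subset_Icc_self hs))) t ht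
  simp only [logVel, primitive_zero, neg_zero, Complex.exp_zero, mul_one] at h
  rw [← h, mul_assoc, ← Complex.exp_add]
  simp [logVel]

theorem norm_vel_eq (hr : 2 ≤ r) (γ : RegularCurve r) {t : ℝ} (ht : t ∈ Icc (0 : ℝ) 1) :
    ‖γ.vel t‖ = ‖γ.vel 0‖ * Real.exp (γ.logVel t).re := by
  rw [γ.vel_eq_mul_exp_logVel hr ht, norm_mul, Complex.norm_exp]

theorem contDiffFamily_norm_vel (hr : 2 ≤ r) {k : ℕ} (hk : ((k + 1 : ℕ) : ℕ∞) ≤ r) :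
    ContDiffFamily k fun (γ : RegularCurve r) t => ‖γ.vel t‖ := by
  have h0 : Continuous fun γ : RegularCurve r => ‖γ.vel 0‖ :=
    ((contDiffFamily_vel hk).continuous_eval continuous_id continuous_const fun _ => by simp).norm
  refine ((ContDiffFamily.const_param h0).mul
    (contDiffFamily_logVel hr hk).re.ofReal.cexp.re).congr fun γ t ht => ?_
  rw [γ.norm_vel_eq hr ht, ← Complex.ofReal_exp, Complex.ofReal_re]

/-- The Euclidean length of the restriction of `γ` to `[0,t]`. -/
def length (γ : RegularCurve r) : ℝ → ℝ := primitive fun s => ‖γ.vel s‖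

theorem contDiffFamily_length (hr : 2 ≤ r) {k : ℕ} (hk : (k : ℕ∞) ≤ r) :
    ContDiffFamily k fun γ : RegularCurve r => γ.length := by
  cases k with
  | zero =>
    exact (contDiffFamily_norm_vel (k := 1) hr hr).of_succ.primitive_zero
  | succ k => exact (contDiffFamily_norm_vel hr hk).primitive

theorem hasDerivWithinAt_length (hr : 2 ≤ r) (γ : RegularCurve r) {t : ℝ}
    (ht : t ∈ Icc (0 : ℝ) 1) : HasDerivWithinAt γ.length ‖γ.vel t‖ (Icc 0 1) t :=
  hasDerivWithinAt_primitive
    ((contDiffFamily_norm_vel (k := 1) hr hr).slice γ) ht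

/-- The argument of `γ'` that is obtained from the initial value `a` by continuation. -/
def angle (a : ℝ) (γ : RegularCurve r) (t : ℝ) : ℝ := a + (γ.logVel t).im

/-- The derivative of `angle a γ`, for every `a`. -/
def angularSpeed (γ : RegularCurve r) (t : ℝ) : ℝ := (γ.acc t * (γ.vel t)⁻¹).im

variable {a : ℝ}

theorem angle_zero (γ : RegularCurve r) : γ.angle a 0 = a := by
  simp [angle, logVel]

theorem contDiffFamily_angle (hr : 2 ≤ r) {k : ℕ} (hk : ((k + 1 : ℕ) : ℕ∞) ≤ r) :
    ContDiffFamily k fun γ : RegularCurve r => γ.angle a :=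
  (ContDiffFamily.const_param continuous_const).add (contDiffFamily_logVel hr hk).im

theorem hasDerivWithinAt_angle (hr : 2 ≤ r) (γ : RegularCurve r) {t : ℝ}
    (ht : t ∈ Icc (0 : ℝ) 1) :
    HasDerivWithinAt (γ.angle a) (γ.angularSpeed t) (Icc 0 1) t :=
  (Complex.imCLM.hasFDerivAt.comp_hasDerivWithinAt t (γ.hasDerivWithinAt_logVel hr ht)).const_add a

theorem vel_eq_norm_mul_exp (hr : 2 ≤ r) (γ : RegularCurve r)
    (ha : γ.vel 0 = ‖γ.vel 0‖ * Complex.exp (a * Complex.I)) {t : ℝ} (ht : t ∈ Icc (0 : ℝ) 1) :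
    γ.vel t = ‖γ.vel t‖ * Complex.exp (γ.angle a t * Complex.I) := by
  rw [γ.norm_vel_eq hr ht, γ.vel_eq_mul_exp_logVel hr ht]
  conv_lhs => rw [ha]
  rw [angle]
  push_cast
  rw [mul_assoc, mul_assoc, ← Complex.exp_add, ← Complex.exp_add]
  congr 2
  conv_lhs => rw [← Complex.re_add_im (γ.logVel t)]
  ring

/-- Total turning is computed by the argument `angle a γ`. -/
theorem angle_one (hr : 2 ≤ r) (γ : RegularCurve r)
    (ha : γ.vel 0 = ‖γ.vel 0‖ * Complex.exp (a * Complex.I)) {τ : ℝ} (hτ : γ.HasTotalTurning τ) :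
    γ.angle a 1 = a + τ := by
  obtain ⟨θ, hθ, rfl⟩ := hτ
  have hex : ∀ t : unitInterval, ∃ n : ℤ, θ t - γ.angle a t = n * (2 * Real.pi) := by
    intro t
    have h1 := hθ t
    rw [γ.velocity_eq] at h1
    have h2 := γ.vel_eq_norm_mul_exp hr ha t.2
    have hne : (‖γ.vel t‖ : ℂ) ≠ 0 := by
      exact_mod_cast (norm_pos_iff.2 (γ.vel_ne_zero t.2)).ne'
    obtain ⟨n, hn⟩ := Complex.exp_eq_exp_iff_exists_int.1 (mul_left_cancel₀ hne (h1.symm.trans h2))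
    refine ⟨n, ?_⟩
    have h3 := congrArg Complex.im hn
    simp at h3
    linarith
  choose n hn using hex
  have hcont : Continuous n := by
    refine Int.isClosedEmbedding_coe_real.isEmbedding.continuous_iff.2 ?_
    have : (Int.cast ∘ n : unitInterval → ℝ) =
        fun t => (θ t - γ.angle a t) / (2 * Real.pi) := by
      funext t
      rw [hn t, mul_div_cancel_right₀ _ (by positivity)]
      rfl
    rw [this]
    refine (θ.continuous.sub ?_).div_const _
    exact (contDiffFamily_angle (k := 1) hr hr).continuous_eval continuous_const
      continuous_subtype_val fun t => t.2
  have h01 : n 0 = n 1 := PreconnectedSpace.constant inferInstance hcont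
  have h0 := hn 0
  have h1 := hn 1
  rw [h01] at h0
  have hz := γ.angle_zero (a := a)
  simp only [Set.Icc.coe_zero, Set.Icc.coe_one] at h0 h1
  linarith

/-! ### Unit tangent and curvature in terms of the argument -/

theorem unitTangent_vec_eq (γ : RegularCurve r) (t : unitInterval) {q θ : ℝ} (hq : 0 < q)
    (h : γ.vel t = q * Complex.exp (θ * Complex.I)) :
    (γ.unitTangent t).vec = (γ.toFun t).im * Complex.exp (θ * Complex.I) := by
  have hy : ((γ.toFun t).im : ℂ) ≠ 0 := by exact_mod_cast (γ.toFun t).im_pos.ne'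
  have hq' : (q : ℂ) ≠ 0 := by exact_mod_cast hq.ne'
  have hs : γ.speed t = q / (γ.toFun t).im := by
    rw [speed, hypNorm_eq (γ.toFun t).im_pos, γ.velocity_eq, h, norm_mul, Complex.norm_real,
      Complex.norm_exp_ofReal_mul_I, mul_one, Real.norm_of_nonneg hq.le]
    rfl
  change γ.velocity t / (γ.speed t : ℂ) = _
  rw [hs, γ.velocity_eq, h]
  push_cast
  field_simp

theorem vel_zero_eq_of_unitTangent_eq {γ δ : RegularCurve r}
    (h : γ.unitTangent 0 = δ.unitTangent 0)
    (hδ : δ.vel 0 = ‖δ.vel 0‖ * Complex.exp (a * Complex.I)) :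
    γ.vel 0 = ‖γ.vel 0‖ * Complex.exp (a * Complex.I) := by
  have hδ0 : 0 < ‖δ.vel 0‖ := norm_pos_iff.2 (δ.vel_ne_zero (by simp))
  have h1 := δ.unitTangent_vec_eq 0 hδ0 hδ
  rw [← h] at h1
  have h2 : γ.velocity 0 / (γ.speed 0 : ℂ) = _ := h1
  have hs : (γ.speed 0 : ℂ) ≠ 0 := by exact_mod_cast (γ.speed_pos 0).ne'
  rw [div_eq_iff hs, γ.velocity_eq, Set.Icc.coe_zero] at h2
  have hpos : 0 ≤ (δ.toFun 0).im * γ.speed 0 :=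
    mul_nonneg (δ.toFun 0).im_pos.le (γ.speed_pos 0).le
  have h3 : γ.vel 0 = ((δ.toFun 0).im * γ.speed 0 : ℝ) * Complex.exp (a * Complex.I) := by
    rw [h2]; push_cast; ring
  have h4 : ‖γ.vel 0‖ = (δ.toFun 0).im * γ.speed 0 := by
    rw [h3, norm_mul, Complex.norm_real, Complex.norm_exp_ofReal_mul_I, mul_one,
      Real.norm_of_nonneg hpos]
  rw [h4, h3]

/-- In terms of the Euclidean speed `q` and the argument `θ`, the hyperbolic curvature at height
`y` is `y θ' / q + cos θ`. -/
theorem curvature_mul (γ : RegularCurve r) {q θ : ℝ → ℝ} {q' θ' : ℝ} (t : unitInterval)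
    (h : ∀ s ∈ Icc (0 : ℝ) 1, γ.vel s = q s * Complex.exp (θ s * Complex.I)) (hq : 0 < q t)
    (hq' : HasDerivWithinAt q q' (Icc 0 1) t) (hθ' : HasDerivWithinAt θ θ' (Icc 0 1) t) :
    γ.curvature t * q t = (γ.toFun t).im * θ' + q t * Real.cos (θ t) := by
  have hacc : γ.acc t = (q' + q t * θ' * Complex.I) * Complex.exp (θ t * Complex.I) := by
    have h1 := hq'.ofReal_comp.mul (hθ'.ofReal_comp.mul_const Complex.I).cexp
    have h2 := (h1.congr h (h t t.2)).derivWithin (uniqueDiffOn_unitInterval t t.2)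
    rw [acc, h2]
    ring
  have hy : 0 < (γ.toFun t).im := (γ.toFun t).im_pos
  have hs : γ.speed t = q t / (γ.toFun t).im := by
    rw [speed, hypNorm_eq (γ.toFun t).im_pos, γ.velocity_eq, h t t.2, norm_mul, Complex.norm_real,
      Complex.norm_exp_ofReal_mul_I, mul_one, Real.norm_of_nonneg hq.le]
    rfl
  rw [curvature, acceleration, unitNormal, γ.unitTangent_vec_eq t hq (h t t.2), hs, γ.nthDeriv_two,
    γ.velocity_eq, h t t.2, hacc, christoffel, hypInner]
  have hexp : Complex.exp (θ t * Complex.I) = Real.cos (θ t) + Real.sin (θ t) * Complex.I := by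
    rw [Complex.exp_mul_I, Complex.ofReal_cos, Complex.ofReal_sin]
  rw [hexp, UpperHalfPlane.coe_im]
  have hcs := Real.sin_sq_add_cos_sq (θ t)
  generalize Real.cos (θ t) = C at *
  generalize Real.sin (θ t) = S at *
  generalize (γ.toFun t).im = y at *
  generalize q t = Q at *
  have key : (((q' + Q * θ' * Complex.I) * (C + S * Complex.I) +
      Complex.I * (Q * (C + S * Complex.I)) * (Q * (C + S * Complex.I)) / (y : ℂ)) *
      (starRingEnd ℂ) (Complex.I * (y * (C + S * Complex.I)))).re =
      Q * (y * θ' + Q * C) * (S ^ 2 + C ^ 2) := by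
    have e : ∀ z : ℂ, z / (y : ℂ) = ((y⁻¹ : ℝ) : ℂ) * z := by
      intro z; push_cast; rw [div_eq_mul_inv, mul_comm]
    rw [e]
    simp
    field_simp
    ring
  rw [key, hcs]
  field_simp

end RegularCurve

/-! ### Consequences of the curvature bounds -/

theorem one_le_or_le_neg_one_of_disjoint {κ₁ κ₂ : EReal} (hκ : κ₁ < κ₂)
    (hdisj : Disjoint (Ioo κ₁ κ₂) (Icc (-1 : EReal) 1)) : 1 ≤ κ₁ ∨ κ₂ ≤ -1 := by
  by_contra! h
  have h11 : (-1 : EReal) < 1 := by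
    rw [← EReal.coe_one, ← EReal.coe_neg, EReal.coe_lt_coe_iff]; norm_num
  obtain ⟨c, hc, hc'⟩ := exists_between (max_lt (lt_min hκ h.1) (lt_min h.2 h11))
  rw [max_lt_iff] at hc
  rw [lt_min_iff] at hc'
  exact Set.disjoint_left.1 hdisj ⟨hc.1, hc'.1⟩ ⟨hc.2.le, hc'.2.le⟩

/-- A weighted mean of elements of `(κ₁, κ₂)` is in `(κ₁, κ₂)`. -/
theorem mem_Ioo_of_weighted_mean {κ₁ κ₂ : EReal} {K K₀ L m m₀ : ℝ} (hK : (K : EReal) ∈ Ioo κ₁ κ₂)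
    (hK₀ : (K₀ : EReal) ∈ Ioo κ₁ κ₂) (hm : 0 ≤ m) (hm₀ : 0 ≤ m₀) (hpos : 0 < m + m₀)
    (h : L * (m + m₀) = m * K + m₀ * K₀) : (L : EReal) ∈ Ioo κ₁ κ₂ := by
  have h1 : min K K₀ ≤ L := by
    refine le_of_mul_le_mul_right ?_ hpos
    rw [h, mul_add, mul_comm m, mul_comm m₀]
    gcongr
    exacts [min_le_left _ _, min_le_right _ _]
  have h2 : L ≤ max K K₀ := by
    refine le_of_mul_le_mul_right ?_ hpos
    rw [h, mul_add, mul_comm m, mul_comm m₀]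
    gcongr
    exacts [le_max_left _ _, le_max_right _ _]
  constructor
  · refine lt_of_lt_of_le ?_ (EReal.coe_le_coe_iff.2 h1)
    rcases min_choice K K₀ with e | e <;> rw [e]
    exacts [hK.1, hK₀.1]
  · refine lt_of_le_of_lt (EReal.coe_le_coe_iff.2 h2) ?_
    rcases max_choice K K₀ with e | e <;> rw [e]
    exacts [hK.2, hK₀.2]

namespace RegularCurve

variable {r : ℕ∞} {a : ℝ}

theorem norm_vel_pos (γ : RegularCurve r) {t : ℝ} (ht : t ∈ Icc (0 : ℝ) 1) : 0 < ‖γ.vel t‖ :=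
  norm_pos_iff.2 (γ.vel_ne_zero ht)

theorem curvature_mul_norm (hr : 2 ≤ r) (γ : RegularCurve r)
    (ha : γ.vel 0 = ‖γ.vel 0‖ * Complex.exp (a * Complex.I)) (t : unitInterval) :
    γ.curvature t * ‖γ.vel t‖ =
      (γ.toFun t).im * γ.angularSpeed t + ‖γ.vel t‖ * Real.cos (γ.angle a t) :=
  γ.curvature_mul (q := fun s => ‖γ.vel s‖) t (fun _ hs => γ.vel_eq_norm_mul_exp hr ha hs)
    (γ.norm_vel_pos t.2)
    ((contDiffFamily_norm_vel (k := 1) hr hr).hasDerivWithinAt γ t.2)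
    (γ.hasDerivWithinAt_angle hr t.2)

theorem exists_direction (γ : RegularCurve r) :
    ∃ a : ℝ, γ.vel 0 = ‖γ.vel 0‖ * Complex.exp (a * Complex.I) :=
  ⟨(γ.vel 0).arg, (Complex.norm_mul_exp_arg_mul_I _).symm⟩

/-- If the curvature avoids `[-1,1]`, then its sign is the sign of the derivative of the
(Euclidean) argument. -/
theorem exists_sign_angularSpeed (hr : 2 ≤ r) {κ₁ κ₂ : EReal} (h : 1 ≤ κ₁ ∨ κ₂ ≤ -1) :
    ∃ σ : ℝ, ∀ γ : RegularCurve r, (∀ t, (γ.curvature t : EReal) ∈ Ioo κ₁ κ₂) →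
      ∀ t ∈ Icc (0 : ℝ) 1, 0 < σ * γ.angularSpeed t := by
  have key : ∀ (γ : RegularCurve r) (t : unitInterval), ∃ c, |c| ≤ 1 ∧
      (γ.curvature t - c) * ‖γ.vel t‖ = (γ.toFun t).im * γ.angularSpeed t := by
    intro γ t
    obtain ⟨a, ha⟩ := γ.exists_direction
    refine ⟨Real.cos (γ.angle a t), Real.abs_cos_le_one _, ?_⟩
    linarith [γ.curvature_mul_norm hr ha t]
  rcases h with h | h
  · refine ⟨1, fun γ hγ t ht => ?_⟩
    obtain ⟨c, hc, hc'⟩ := key γ ⟨t, ht⟩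
    have h1 : 1 < γ.curvature ⟨t, ht⟩ := by
      have := h.trans_lt (hγ ⟨t, ht⟩).1
      exact_mod_cast this
    have h2 := mul_pos (sub_pos.2 ((abs_le.1 hc).2.trans_lt h1)) (γ.norm_vel_pos ht)
    rw [one_mul]
    exact pos_of_mul_pos_right (hc' ▸ h2) (γ.toFun ⟨t, ht⟩).im_pos.le
  · refine ⟨-1, fun γ hγ t ht => ?_⟩
    obtain ⟨c, hc, hc'⟩ := key γ ⟨t, ht⟩
    have h1 : γ.curvature ⟨t, ht⟩ < -1 := by
      have := (hγ ⟨t, ht⟩).2.trans_le h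
      rw [← EReal.coe_one, ← EReal.coe_neg] at this
      exact_mod_cast this
    have h2 := mul_pos (sub_pos.2 (h1.trans_le (abs_le.1 hc).1)) (γ.norm_vel_pos ht)
    have h3 : 0 < (γ.toFun ⟨t, ht⟩).im * (-1 * γ.angularSpeed t) := by
      have : (γ.toFun ⟨t, ht⟩).im * (-1 * γ.angularSpeed t) =
          (c - γ.curvature ⟨t, ht⟩) * ‖γ.vel t‖ := by linear_combination hc'
      rw [this]
      exact h2
    exact pos_of_mul_pos_right h3 (γ.toFun ⟨t, ht⟩).im_pos.le

theorem unitTangent_congr {γ δ : RegularCurve r} {t : unitInterval} {p q θ : ℝ}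
    (h : γ.toFun t = δ.toFun t) (hp : 0 < p) (hq : 0 < q)
    (hγ : γ.vel t = p * Complex.exp (θ * Complex.I))
    (hδ : δ.vel t = q * Complex.exp (θ * Complex.I)) : γ.unitTangent t = δ.unitTangent t := by
  refine UnitTangent.ext h ?_
  rw [γ.unitTangent_vec_eq t hp hγ, δ.unitTangent_vec_eq t hq hδ, h]

end RegularCurve

open RegularCurve

variable {r : ℕ∞} {κ₁ κ₂ : EReal} {u v : UnitTangent} {τ a : ℝ}

theorem canonicalSubspace_vel_zero {γ δ : RegularCurve r}
    (hγ : γ ∈ canonicalSubspace r κ₁ κ₂ u v τ) (hδ : δ ∈ canonicalSubspace r κ₁ κ₂ u v τ)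
    (ha : δ.vel 0 = ‖δ.vel 0‖ * Complex.exp (a * Complex.I)) :
    γ.vel 0 = ‖γ.vel 0‖ * Complex.exp (a * Complex.I) :=
  vel_zero_eq_of_unitTangent_eq (hγ.1.1.trans hδ.1.1.symm) ha

/-! ### Convex combinations of curves with matched arguments -/

/-- Let `β` match the arguments of `γ` and `γ₀`, that is, let `γ₀ ∘ β` and `γ` have the same
argument. Then a regular curve `δ` that is a reparametrization of the Euclidean convex combination
`(1 - s) γ + s (γ₀ ∘ β)` belongs to the same canonical subspace: its curvature is a weighted mean of
the curvatures of `γ` and `γ₀`. -/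
theorem mem_canonicalSubspace_of_convexCombination (hr : 2 ≤ r) {γ γ₀ δ : RegularCurve r}
    (hγ : γ ∈ canonicalSubspace r κ₁ κ₂ u v τ) (hγ₀ : γ₀ ∈ canonicalSubspace r κ₁ κ₂ u v τ)
    (ha : γ₀.vel 0 = ‖γ₀.vel 0‖ * Complex.exp (a * Complex.I)) (s : unitInterval)
    {β β' χ χ' g : ℝ → ℝ}
    (hβmem : ∀ t ∈ Icc (0 : ℝ) 1, β t ∈ Icc (0 : ℝ) 1) (hβ0 : β 0 = 0) (hβ1 : β 1 = 1)
    (hβ : ∀ t ∈ Icc (0 : ℝ) 1, γ₀.angle a (β t) = γ.angle a t)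
    (hβpos : ∀ t ∈ Icc (0 : ℝ) 1, 0 < β' t)
    (hβ' : ∀ t ∈ Icc (0 : ℝ) 1, γ.angularSpeed t = γ₀.angularSpeed (β t) * β' t)
    (hχmem : ∀ t ∈ Icc (0 : ℝ) 1, χ t ∈ Icc (0 : ℝ) 1) (hχ0 : χ 0 = 0) (hχ1 : χ 1 = 1)
    (hχ' : ∀ t ∈ Icc (0 : ℝ) 1, HasDerivWithinAt χ (χ' t) (Icc 0 1) t)
    (hg : ∀ t ∈ Icc (0 : ℝ) 1, g t = χ' t *
      ((1 - s) * ‖γ.vel (χ t)‖ + s * (‖γ₀.vel (β (χ t))‖ * β' (χ t))))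
    (hgpos : ∀ t ∈ Icc (0 : ℝ) 1, 0 < g t) (hgd : DifferentiableOn ℝ g (Icc 0 1))
    (hδ : ∀ t : unitInterval, (δ.toFun t : ℂ) =
      (1 - (s : ℝ) : ℝ) • extend γ.toFun (χ t) + (s : ℝ) • extend γ₀.toFun (β (χ t)))
    (hvel : ∀ t ∈ Icc (0 : ℝ) 1, δ.vel t = g t * Complex.exp (γ.angle a (χ t) * Complex.I)) :
    δ ∈ canonicalSubspace r κ₁ κ₂ u v τ := by
  have haγ := canonicalSubspace_vel_zero hγ hγ₀ ha
  have m0 : (0 : ℝ) ∈ Icc (0 : ℝ) 1 := by simp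
  have m1 : (1 : ℝ) ∈ Icc (0 : ℝ) 1 := by simp
  -- applied at the endpoints `t = 0` and `t = 1`, which `χ` and `β` fix
  have hend : ∀ t : unitInterval, χ t = t → β t = t → γ.unitTangent t = γ₀.unitTangent t →
      δ.unitTangent t = γ.unitTangent t := by
    intro t hχt hβt htan
    have hbase : γ.toFun t = γ₀.toFun t := congrArg UnitTangent.base htan
    refine unitTangent_congr (θ := γ.angle a t) ?_ (hgpos t t.2) (γ.norm_vel_pos t.2) ?_
      (γ.vel_eq_norm_mul_exp hr haγ t.2)
    · refine UpperHalfPlane.ext ?_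
      rw [hδ, hχt, hβt, extend_coe, extend_coe, ← hbase, ← add_smul, sub_add_cancel, one_smul]
    · rw [hvel t t.2, hχt]
  refine ⟨⟨?_, ?_, fun t => ?_⟩, ?_⟩
  · rw [hend 0 (by simpa using hχ0) (by simpa using hβ0) (hγ.1.1.trans hγ₀.1.1.symm), hγ.1.1]
  · rw [hend 1 (by simpa using hχ1) (by simpa using hβ1) (hγ.1.2.1.trans hγ₀.1.2.1.symm), hγ.1.2.1]
  · have hc := hχmem t t.2
    have hb := hβmem _ hc
    have hs0 : (0 : ℝ) ≤ s := s.2.1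
    have hs1 : (0 : ℝ) ≤ 1 - s := sub_nonneg.2 s.2.2
    have eγ := γ.curvature_mul_norm hr haγ ⟨χ t, hc⟩
    have eγ₀ := γ₀.curvature_mul_norm hr ha ⟨β (χ t), hb⟩
    have eδ := δ.curvature_mul t hvel (hgpos t t.2) (hgd t t.2).hasDerivWithinAt
      (((γ.hasDerivWithinAt_angle (a := a) hr hc).scomp (t : ℝ) (hχ' t t.2) hχmem))
    have him : (δ.toFun t).im = (1 - s) * (γ.toFun ⟨χ t, hc⟩).im +
        s * (γ₀.toFun ⟨β (χ t), hb⟩).im := by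
      have h1 := congrArg Complex.im (hδ t)
      have h2 := extend_coe γ.toFun ⟨χ t, hc⟩
      have h3 := extend_coe γ₀.toFun ⟨β (χ t), hb⟩
      simp only at h2 h3
      rw [h2, h3] at h1
      simpa using h1
    simp only [smul_eq_mul] at eγ eγ₀ eδ
    rw [hβ _ hc] at eγ₀
    have hm : 0 ≤ (1 - (s : ℝ)) * ‖γ.vel (χ t)‖ := mul_nonneg hs1 (norm_nonneg _)
    have hm₀ : 0 ≤ (s : ℝ) * (‖γ₀.vel (β (χ t))‖ * β' (χ t)) :=
      mul_nonneg hs0 (mul_nonneg (norm_nonneg _) (hβpos _ hc).le)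
    have hgt := hgpos t t.2
    have hχne : χ' t ≠ 0 := by
      intro h
      rw [hg t t.2, h, zero_mul] at hgt
      exact lt_irrefl _ hgt
    refine mem_Ioo_of_weighted_mean (hγ.1.2.2 ⟨χ t, hc⟩) (hγ₀.1.2.2 ⟨β (χ t), hb⟩) hm hm₀ ?_ ?_
    · refine (add_nonneg hm hm₀).lt_of_ne fun h => ?_
      rw [hg t t.2, ← h, mul_zero] at hgt
      exact lt_irrefl _ hgt
    · refine mul_left_cancel₀ hχne ?_
      rw [hg t t.2, him, hβ' _ hc] at eδ
      rw [hβ' _ hc] at eγ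
      linear_combination eδ - χ' t * (1 - s) * eγ - χ' t * s * β' (χ t) * eγ₀
  · refine ⟨⟨fun t => γ.angle a (χ t), ?_⟩, fun t => ?_, ?_⟩
    · have h1 : ContinuousOn (γ.angle a) (Icc 0 1) :=
        fun t ht => (γ.hasDerivWithinAt_angle hr ht).continuousWithinAt
      have h2 : ContinuousOn χ (Icc 0 1) := fun t ht => (hχ' t ht).continuousWithinAt
      exact (h1.comp h2 hχmem).comp_continuous continuous_subtype_val fun t => t.2
    · rw [δ.velocity_eq, hvel t t.2, norm_mul, Complex.norm_exp_ofReal_mul_I, mul_one,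
        Complex.norm_real, Real.norm_of_nonneg (hgpos t t.2).le]
      rfl
    · change γ.angle a (χ (1 : unitInterval)) - γ.angle a (χ (0 : unitInterval)) = τ
      rw [Set.Icc.coe_zero, Set.Icc.coe_one, hχ0, hχ1, γ.angle_one hr haγ hγ.2, γ.angle_zero]
      ring

/-- The reparametrizations `β γ` of `[0,1]` such that `γ₀ ∘ β γ` and `γ` have the same argument. -/
theorem exists_matching (hr : 2 ≤ r) {γ₀ : RegularCurve r}
    (hγ₀ : γ₀ ∈ canonicalSubspace r κ₁ κ₂ u v τ)
    (ha : γ₀.vel 0 = ‖γ₀.vel 0‖ * Complex.exp (a * Complex.I)) {σ : ℝ}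
    (hσ : ∀ γ ∈ canonicalSubspace r κ₁ κ₂ u v τ, ∀ t ∈ Icc (0 : ℝ) 1, 0 < σ * γ.angularSpeed t) :
    ∃ β β' : canonicalSubspace r κ₁ κ₂ u v τ → ℝ → ℝ,
      (∀ γ, ∀ t ∈ Icc (0 : ℝ) 1, β γ t ∈ Icc (0 : ℝ) 1) ∧
      (∀ γ, ∀ t ∈ Icc (0 : ℝ) 1, γ₀.angle a (β γ t) = γ.1.angle a t) ∧
      (∀ γ, β γ 0 = 0) ∧ (∀ γ, β γ 1 = 1) ∧
      (∀ γ, ∀ t ∈ Icc (0 : ℝ) 1, 0 < β' γ t) ∧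
      (∀ γ : canonicalSubspace r κ₁ κ₂ u v τ, ∀ t ∈ Icc (0 : ℝ) 1,
        γ.1.angularSpeed t = γ₀.angularSpeed (β γ t) * β' γ t) ∧
      (∀ γ, ∀ t ∈ Icc (0 : ℝ) 1, HasDerivWithinAt (β γ) (β' γ t) (Icc 0 1) t) ∧
      ∀ k : ℕ, ((k + 1 : ℕ) : ℕ∞) ≤ r → ContDiffFamily k β := by
  have hσ0 : σ ≠ 0 := by
    rintro rfl
    simpa using hσ γ₀ hγ₀ 0 (by simp)
  let P : canonicalSubspace r κ₁ κ₂ u v τ → ℝ → ℝ := fun _ t => σ * γ₀.angle a t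
  let G : canonicalSubspace r κ₁ κ₂ u v τ → ℝ → ℝ := fun γ t => σ * γ.1.angle a t
  have hG : ∀ k : ℕ, ((k + 1 : ℕ) : ℕ∞) ≤ r → ContDiffFamily k G := fun k hk =>
    (ContDiffFamily.const_param (X := canonicalSubspace r κ₁ κ₂ u v τ) (c := fun _ => σ)
      continuous_const).mul
      ((contDiffFamily_angle hr hk).comp_param continuous_subtype_val)
  have hP : ∀ k : ℕ, ((k + 1 : ℕ) : ℕ∞) ≤ r → ContDiffFamily k P := fun k hk =>
    (hG k hk).comp_param (φ := fun _ => (⟨γ₀, hγ₀⟩ : canonicalSubspace r κ₁ κ₂ u v τ))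
      continuous_const
  have hGd : ∀ γ : canonicalSubspace r κ₁ κ₂ u v τ, ∀ t ∈ Icc (0 : ℝ) 1,
      derivWithin (G γ) (Icc 0 1) t = σ * γ.1.angularSpeed t := fun γ t ht =>
    ((γ.1.hasDerivWithinAt_angle hr ht).const_mul σ).derivWithin (uniqueDiffOn_unitInterval t ht)
  have hPd : ∀ γ, ∀ t ∈ Icc (0 : ℝ) 1,
      derivWithin (P γ) (Icc 0 1) t = σ * γ₀.angularSpeed t := fun γ t ht =>
    hGd ⟨γ₀, hγ₀⟩ t ht
  have hGpos : ∀ γ, ∀ t ∈ Icc (0 : ℝ) 1, 0 < derivWithin (G γ) (Icc 0 1) t := fun γ t ht =>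
    hGd γ t ht ▸ hσ γ.1 γ.2 t ht
  have hPpos : ∀ γ, ∀ t ∈ Icc (0 : ℝ) 1, 0 < derivWithin (P γ) (Icc 0 1) t := fun γ t ht =>
    hPd γ t ht ▸ hσ γ₀ hγ₀ t ht
  obtain ⟨β, hmem, heq, h0, h1, hd, hk⟩ := exists_reparametrization (hP 1 hr) (hG 1 hr) hPpos hGpos
    (fun γ => by simp only [P, G, angle_zero])
    (fun γ => by
      simp only [P, G, γ₀.angle_one hr ha hγ₀.2,
        γ.1.angle_one hr (canonicalSubspace_vel_zero γ.2 hγ₀ ha) γ.2.2])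
  refine ⟨β, fun γ t => derivWithin (G γ) (Icc 0 1) t / derivWithin (P γ) (Icc 0 1) (β γ t), hmem,
    fun γ t ht => mul_left_cancel₀ hσ0 (heq γ t ht), h0, h1,
    fun γ t ht => div_pos (hGpos γ t ht) (hPpos γ _ (hmem γ t ht)), fun γ t ht => ?_, hd,
    fun k hk' => hk k (hP k hk') (hG k hk')⟩
  have hne : γ₀.angularSpeed (β γ t) ≠ 0 := by
    intro h
    simpa [h] using hσ γ₀ hγ₀ _ (hmem γ t ht)
  simp only
  rw [hGd γ t ht, hPd γ _ (hmem γ t ht)]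
  field_simp

/-- The contraction. It sends `γ` at the time `s` to the Euclidean convex combination of `γ` and of
`γ₀`, reparametrized to have the argument of `γ`; a second reparametrization `χ`, which
makes the arc length equal to the convex combination of the arc lengths of `γ` and `γ₀`, restores
the regularity `C^r`. -/
theorem contractibleSpace_canonicalSubspace (hr : 2 ≤ r) {γ₀ : RegularCurve r}
    (hγ₀ : γ₀ ∈ canonicalSubspace r κ₁ κ₂ u v τ) {σ : ℝ}
    (hσ : ∀ γ ∈ canonicalSubspace r κ₁ κ₂ u v τ, ∀ t ∈ Icc (0 : ℝ) 1, 0 < σ * γ.angularSpeed t) :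
    ContractibleSpace (canonicalSubspace r κ₁ κ₂ u v τ) := by
  obtain ⟨a, ha⟩ := γ₀.exists_direction
  obtain ⟨β, β', hβmem, hβ, hβ0, hβ1, hβpos, hβ', hβd, hβk⟩ := exists_matching hr hγ₀ ha hσ
  let S := canonicalSubspace r κ₁ κ₂ u v τ
  let X := unitInterval × S
  have hs : Continuous fun x : X => (x.1 : ℝ) := continuous_subtype_val.comp continuous_fst
  have hs0 : ∀ x : X, (0 : ℝ) ≤ x.1 := fun x => x.1.2.1
  have hs1 : ∀ x : X, (0 : ℝ) ≤ 1 - x.1 := fun x => sub_nonneg.2 x.1.2.2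
  have m0 : (0 : ℝ) ∈ Icc (0 : ℝ) 1 := by simp
  have m1 : (1 : ℝ) ∈ Icc (0 : ℝ) 1 := by simp
  have hcomb_pos : ∀ (x : X) {p q : ℝ}, 0 < p → 0 < q →
      0 < (1 - (x.1 : ℝ)) * p + x.1 * q := fun x p q hp hq =>
    convex_Ioi (0 : ℝ) hp hq (hs1 x) (hs0 x) (sub_add_cancel _ _)
  -- `C^k` families indexed by `X`
  have hS : ∀ {E : Type} [NormedAddCommGroup E] [NormedSpace ℝ E] {k : ℕ}
      {f : RegularCurve r → ℝ → E}, ContDiffFamily k f → ContDiffFamily k fun x : X => f x.2.1 :=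
    fun hf => hf.comp_param (continuous_subtype_val.comp continuous_snd)
  have hS₀ : ∀ {E : Type} [NormedAddCommGroup E] [NormedSpace ℝ E] {k : ℕ}
      {f : RegularCurve r → ℝ → E}, ContDiffFamily k f → ContDiffFamily k fun _ : X => f γ₀ :=
    fun hf => hf.comp_param continuous_const
  have hcomb : ∀ {E : Type} [NormedAddCommGroup E] [NormedSpace ℝ E] {k : ℕ} {f g : X → ℝ → E},
      ContDiffFamily k f → ContDiffFamily k g →
      ContDiffFamily k fun x t => (1 - x.1 : ℝ) • f x t + (x.1 : ℝ) • g x t := fun hf hg =>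
    ((ContDiffFamily.const_param (c := fun x : X => (1 - x.1 : ℝ)) (continuous_const.sub hs)).smul hf).add
      ((ContDiffFamily.const_param (c := fun x : X => (x.1 : ℝ)) hs).smul hg)
  have hβX : ∀ k : ℕ, ((k + 1 : ℕ) : ℕ∞) ≤ r → ContDiffFamily k fun x : X => β x.2 :=
    fun k hk => (hβk k hk).comp_param continuous_snd
  -- the arc lengths before and after the second reparametrization, and their derivatives
  let P : X → ℝ → ℝ := fun x t =>
    (1 - x.1 : ℝ) • x.2.1.length t + (x.1 : ℝ) • γ₀.length (β x.2 t)
  let G : X → ℝ → ℝ := fun x t => (1 - x.1 : ℝ) • x.2.1.length t + (x.1 : ℝ) • γ₀.length t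
  let w : X → ℝ → ℝ := fun x t =>
    (1 - x.1) * ‖x.2.1.vel t‖ + x.1 * (‖γ₀.vel (β x.2 t)‖ * β' x.2 t)
  let g : X → ℝ → ℝ := fun x t => (1 - x.1 : ℝ) • ‖x.2.1.vel t‖ + (x.1 : ℝ) • ‖γ₀.vel t‖
  have hwpos : ∀ x, ∀ t ∈ Icc (0 : ℝ) 1, 0 < w x t := fun x t ht =>
    hcomb_pos x (x.2.1.norm_vel_pos ht)
      (mul_pos (γ₀.norm_vel_pos (hβmem _ t ht)) (hβpos _ t ht))
  have hgpos : ∀ x, ∀ t ∈ Icc (0 : ℝ) 1, 0 < g x t := fun x t ht =>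
    hcomb_pos x (x.2.1.norm_vel_pos ht) (γ₀.norm_vel_pos ht)
  have hPd : ∀ x, ∀ t ∈ Icc (0 : ℝ) 1, HasDerivWithinAt (P x) (w x t) (Icc 0 1) t := by
    intro x t ht
    refine (((x.2.1.hasDerivWithinAt_length hr ht).const_smul (1 - x.1 : ℝ)).add
      (((γ₀.hasDerivWithinAt_length hr (hβmem x.2 t ht)).scomp t (hβd x.2 t ht)
        (hβmem x.2)).const_smul (x.1 : ℝ))).congr_deriv ?_
    simp only [w, smul_eq_mul]
    ring
  have hGd : ∀ x, ∀ t ∈ Icc (0 : ℝ) 1, HasDerivWithinAt (G x) (g x t) (Icc 0 1) t :=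
    fun x t ht => ((x.2.1.hasDerivWithinAt_length hr ht).const_smul (1 - x.1 : ℝ)).add
      ((γ₀.hasDerivWithinAt_length hr ht).const_smul (x.1 : ℝ))
  have hPd' : ∀ x, ∀ t ∈ Icc (0 : ℝ) 1, derivWithin (P x) (Icc 0 1) t = w x t := fun x t ht =>
    (hPd x t ht).derivWithin (uniqueDiffOn_unitInterval t ht)
  have hGd' : ∀ x, ∀ t ∈ Icc (0 : ℝ) 1, derivWithin (G x) (Icc 0 1) t = g x t := fun x t ht =>
    (hGd x t ht).derivWithin (uniqueDiffOn_unitInterval t ht)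
  have hlen : ∀ {k : ℕ}, ((k + 1 : ℕ) : ℕ∞) ≤ r →
      ContDiffFamily k fun γ : RegularCurve r => γ.length := fun hk =>
    (contDiffFamily_length hr hk).of_succ
  have hPk : ∀ k : ℕ, ((k + 1 : ℕ) : ℕ∞) ≤ r → ContDiffFamily k P := fun k hk =>
    hcomb (hS (hlen hk)) ((hS₀ (hlen hk)).comp (hβX k hk) fun x => hβmem x.2)
  have hGk : ∀ k : ℕ, ((k + 1 : ℕ) : ℕ∞) ≤ r → ContDiffFamily k G := fun k hk =>
    hcomb (hS (hlen hk)) (hS₀ (hlen hk))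
  have hgk : ∀ k : ℕ, ((k + 1 : ℕ) : ℕ∞) ≤ r → ContDiffFamily k g := fun k hk =>
    hcomb (hS (contDiffFamily_norm_vel hr hk)) (hS₀ (contDiffFamily_norm_vel hr hk))
  obtain ⟨χ, hχmem, hχ, hχ0, hχ1, hχd, hχk⟩ := exists_reparametrization (hPk 1 hr) (hGk 1 hr)
    (fun x t ht => hPd' x t ht ▸ hwpos x t ht) (fun x t ht => hGd' x t ht ▸ hgpos x t ht)
    (fun x => by simp only [P, G, hβ0]) (fun x => by simp only [P, G, hβ1])
  have hχd' : ∀ x, ∀ t ∈ Icc (0 : ℝ) 1,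
      HasDerivWithinAt (χ x) (g x t / w x (χ x t)) (Icc 0 1) t := by
    intro x t ht
    rw [← hGd' x t ht, ← hPd' x _ (hχmem x t ht)]
    exact hχd x t ht
  have hβχ : ∀ x : X, ∀ t ∈ Icc (0 : ℝ) 1, β x.2 (χ x t) ∈ Icc (0 : ℝ) 1 := fun x t ht =>
    hβmem _ _ (hχmem x t ht)
  -- the deformed curves
  let F : X → ℝ → ℂ := fun x t =>
    (1 - x.1 : ℝ) • extend x.2.1.toFun (χ x t) + (x.1 : ℝ) • extend γ₀.toFun (β x.2 (χ x t))
  have hFd : ∀ x, ∀ t ∈ Icc (0 : ℝ) 1, HasDerivWithinAt (F x)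
      (g x t * Complex.exp (x.2.1.angle a (χ x t) * Complex.I)) (Icc 0 1) t := by
    intro x t ht
    have hc := hχmem x t ht
    have h1 := (x.2.1.hasDerivWithinAt_extend hr hc).scomp t (hχd' x t ht) (hχmem x)
    have h2 := (γ₀.hasDerivWithinAt_extend hr (hβχ x t ht)).scomp t
      ((hβd x.2 _ hc).scomp t (hχd' x t ht) (hχmem x)) (hβχ x)
    refine ((h1.const_smul (1 - x.1 : ℝ)).add (h2.const_smul (x.1 : ℝ))).congr_deriv ?_
    rw [x.2.1.vel_eq_norm_mul_exp hr (canonicalSubspace_vel_zero x.2.2 hγ₀ ha) hc,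
      γ₀.vel_eq_norm_mul_exp hr ha (hβχ x t ht), hβ x.2 _ hc]
    have hw : (w x (χ x t) : ℂ) ≠ 0 := by exact_mod_cast (hwpos x _ hc).ne'
    have hw' : (w x (χ x t) : ℂ) = (1 - (x.1 : ℝ)) * ‖x.2.1.vel (χ x t)‖ +
        (x.1 : ℝ) * (‖γ₀.vel (β x.2 (χ x t))‖ * β' x.2 (χ x t)) := by
      simp only [w]; push_cast; ring
    simp only [Complex.real_smul, smul_eq_mul]
    push_cast
    field_simp
    rw [hw']
    ring
  have hFk : ∀ k : ℕ, (k : ℕ∞) ≤ r → ContDiffFamily k F := by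
    have hstep : ∀ k : ℕ, ((k + 1 : ℕ) : ℕ∞) ≤ r → ContDiffFamily k F := fun k hk =>
      hcomb ((hS (contDiffFamily_extend hk).of_succ).comp (hχk k (hPk k hk) (hGk k hk)) hχmem)
        ((hS₀ (contDiffFamily_extend hk).of_succ).comp
          ((hβX k hk).comp (hχk k (hPk k hk) (hGk k hk)) hχmem) hβχ)
    intro k hk
    cases k with
    | zero => exact (hstep 1 hr).of_succ
    | succ k =>
      have hθ := (hS (contDiffFamily_angle (a := a) hr hk)).comp
        (hχk k (hPk k hk) (hGk k hk)) hχmem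
      exact .succ_of_hasDerivWithinAt ((hstep 1 hr).of_succ) hFd ((hgk k hk).ofReal.mul
        (hθ.ofReal.mul (.const_param (c := fun _ => Complex.I) continuous_const)).cexp)
  have hFim : ∀ x (t : unitInterval), 0 < (F x t).im := by
    intro x t
    have hpos : ∀ (γ : RegularCurve r) {c : ℝ}, c ∈ Icc (0 : ℝ) 1 → 0 < (extend γ.toFun c).im := by
      intro γ c hc
      rw [show extend γ.toFun c = γ.toFun ⟨c, hc⟩ from extend_coe γ.toFun ⟨c, hc⟩]
      exact (γ.toFun _).im_pos
    have := hcomb_pos x (hpos x.2.1 (hχmem x t t.2)) (hpos γ₀ (hβχ x t t.2))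
    simpa [F] using this
  have hext : ∀ x, ∀ t ∈ Icc (0 : ℝ) 1,
      extend (fun t : unitInterval => (⟨F x t, hFim x t⟩ : ℍ)) t = F x t := fun x t ht =>
    extend_coe (fun t : unitInterval => (⟨F x t, hFim x t⟩ : ℍ)) ⟨t, ht⟩
  have hextk : ∀ k : ℕ, (k : ℕ∞) ≤ r → ContDiffFamily k fun x =>
      extend (fun t : unitInterval => (⟨F x t, hFim x t⟩ : ℍ)) := fun k hk =>
    (hFk k hk).congr hext
  have hextd : ∀ x, ∀ t ∈ Icc (0 : ℝ) 1,
      derivWithin (extend (fun t : unitInterval => (⟨F x t, hFim x t⟩ : ℍ))) (Icc 0 1) t =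
        g x t * Complex.exp (x.2.1.angle a (χ x t) * Complex.I) := fun x t ht =>
    ((hFd x t ht).congr (hext x) (hext x t ht)).derivWithin (uniqueDiffOn_unitInterval t ht)
  let δ : X → RegularCurve r := fun x =>
    { toFun := fun t => ⟨F x t, hFim x t⟩
      contDiffOn := contDiffOn_iff_forall_nat_le.2 fun k hk =>
        (hextk k (by exact_mod_cast hk)).contDiffOn x
      regular := fun t => by
        rw [nthDeriv, iteratedDerivWithin_one, hextd x t t.2]
        exact mul_ne_zero (by exact_mod_cast (hgpos x t t.2).ne') (Complex.exp_ne_zero _) }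
  have hδ : Continuous δ := continuous_of_contDiffFamily hextk
  have hδmem : ∀ x, δ x ∈ S := fun x =>
    mem_canonicalSubspace_of_convexCombination hr x.2.2 hγ₀ ha x.1 (hβmem x.2) (hβ0 x.2) (hβ1 x.2)
      (hβ x.2) (hβpos x.2) (hβ' x.2) (hχmem x) (hχ0 x) (hχ1 x) (hχd' x)
      (fun t ht => (div_mul_cancel₀ _ (hwpos x _ (hχmem x t ht)).ne').symm) (hgpos x)
      (fun t ht => ((hgk 1 hr).differentiableOn x) t ht) (fun t => rfl) (hextd x)
  have hlen_inj : ∀ γ : RegularCurve r, InjOn γ.length (Icc 0 1) := fun γ =>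
    (strictMonoOn_of_hasDerivWithinAt_pos (fun t ht => γ.hasDerivWithinAt_length hr ht)
      fun t ht => γ.norm_vel_pos ht).injOn
  have hcurve_ext : ∀ {γ η : RegularCurve r}, (∀ t, γ.toFun t = η.toFun t) → γ = η := by
    rintro ⟨f, _, _⟩ ⟨f', _, _⟩ h
    obtain rfl : f = f' := funext h
    rfl
  refine (contractible_iff_id_nullhomotopic S).2 ⟨⟨γ₀, hγ₀⟩, ⟨?_⟩⟩
  refine
    { toFun := fun x => ⟨δ x, hδmem x⟩
      continuous_toFun := hδ.subtype_mk _
      map_zero_left := fun γ => Subtype.ext (hcurve_ext fun t => UpperHalfPlane.ext ?_)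
      map_one_left := fun γ => Subtype.ext (hcurve_ext fun t => UpperHalfPlane.ext ?_) }
  · have h := hχ (0, γ) t t.2
    simp only [P, G, Set.Icc.coe_zero, sub_zero, one_smul, zero_smul, add_zero] at h
    have h' := hlen_inj _ (hχmem (0, γ) t t.2) t.2 h
    change F (0, γ) t = _
    simp only [F, h', Set.Icc.coe_zero, sub_zero, one_smul, zero_smul, add_zero, extend_coe]
    rfl
  · have h := hχ (1, γ) t t.2
    simp only [P, G, Set.Icc.coe_one, sub_self, one_smul, zero_smul, zero_add] at h
    have h' := hlen_inj _ (hβχ (1, γ) t t.2) t.2 h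
    change F (1, γ) t = _
    simp only [F, h', Set.Icc.coe_one, sub_self, one_smul, zero_smul, zero_add, extend_coe]
    rfl

end HypCurves

end

theorem theorem3p2 (r : ℕ∞) (hr : 2 ≤ r) (κ₁ κ₂ : EReal) (hκ : κ₁ < κ₂)
    (hdisj : Disjoint (Set.Ioo κ₁ κ₂) (Set.Icc (-1 : EReal) 1))
    (u v : HypCurves.UnitTangent) (τ : ℝ) :
    HypCurves.canonicalSubspace r κ₁ κ₂ u v τ = ∅ ∨
      ContractibleSpace (HypCurves.canonicalSubspace r κ₁ κ₂ u v τ) := by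
  refine (Set.eq_empty_or_nonempty _).imp_right ?_
  rintro ⟨γ₀, hγ₀⟩
  obtain ⟨σ, hσ⟩ := HypCurves.RegularCurve.exists_sign_angularSpeed hr
    (HypCurves.one_le_or_le_neg_one_of_disjoint hκ hdisj)
  exact HypCurves.contractibleSpace_canonicalSubspace hr hγ₀ fun γ hγ => hσ γ hγ.1.2.2
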